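/- Let $k\ge 2$ and $d\ge 2$ be integers, let $0<a<1$, and let $(\eta_n)_{n\ge 0}$ be non-zero complex numbers with $|\eta_n|\le a^{d^n}$ for every $n\ge 0$. Let $F_n:\mathbb C^k\to\mathbb C^k$ be the automorphisms $$F_n(z_1,\dots,z_k)=(\eta_n z_k,\ z_2^d+\eta_n z_1,\ z_3^d+\eta_n z_2,\ \dots,\ z_k^d+\eta_n z_{k-1}),$$ and let $\Omega=\{z\in\mathbb C^k : F_n\circ\cdots\circ F_0(z)\to 0 \text{ as } n\to\infty\}$ be their non-autonomous basin of attraction at the origin. Then: (i) $\Omega$ is a non-empty open connected set. (ii) $\Omega=\bigcup_{j}\Omega_j$ with $\Omega_j\subset\Omega_{j+1}$ and each $\Omega_j$ a domain biholomorphic to the unit ball of $\mathbb C^k$. (iii) The infinitesimal Kobayashi metric of $\Omega$, i.e. $K_\Omega(p,\xi)=\inf\{1/R : R>0,\ f:\Delta\to\Omega \text{ holomorphic},\ f(0)=p,\ f'(0)=R\xi\}$ with $\Delta$ the open unit disc in $\mathbb C$, vanishes for all $p\in\Omega$ and $\xi\in\mathbb C^k$. (iv) There is a plurisubharmonic function $\psi:\mathbb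 C^k\to[\log a,\infty)$ such that $\Omega=\{z\in\mathbb C^k:\psi(z)<0\}$, and $\psi$ is non-constant on $\Omega$. Moreover $\Omega\ne\mathbb C^k$. Consequently $\Omega$ is a Short $\mathbb C^k$, that is, a domain $\Omega\subsetneq\mathbb C^k$ which is an increasing union of domains biholomorphic to the unit ball, whose infinitesimal Kobayashi metric vanishes identically, and which carries a non-constant bounded plurisubharmonic function. -/

import Mathlib

open Set Filter Topology
open scoped ENNReal

noncomputable section

namespace ShortCk

/-- `ℂ^k` with its Euclidean norm. -/
abbrev Cn (k : ℕ) : Type := EuclideanSpace ℂ (Fin k)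

/-- The map `z ↦ (η z_k, z_2^d + η z_1, …, z_k^d + η z_{k-1})` of `ℂ^k`; coordinates are indexed
from `0` to `k - 1`. -/
def shiftMap (k d : ℕ) (η : ℂ) (z : Cn k) : Cn k :=
  WithLp.toLp 2 fun i : Fin k =>
    if i.val = 0 then η * z ⟨k - 1, Nat.sub_lt i.pos one_pos⟩
    else z i ^ d + η * z ⟨i.val - 1, (Nat.sub_le _ _).trans_lt i.isLt⟩

/-- The composition `F_n ∘ ⋯ ∘ F_0`. -/
def compUpTo {X : Type*} (F : ℕ → X → X) : ℕ → X → X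
  | 0 => F 0
  | n + 1 => F (n + 1) ∘ compUpTo F n

/-- The non-autonomous basin of attraction of the sequence `F` at the origin. -/
def basin {k : ℕ} (F : ℕ → Cn k → Cn k) : Set (Cn k) :=
  {z | Tendsto (fun n => compUpTo F n z) atTop (𝓝 0)}

/-- Biholomorphic equivalence of two (open) subsets of `ℂ^k`. -/
def Biholomorphic {k : ℕ} (U V : Set (Cn k)) : Prop :=
  ∃ f g : Cn k → Cn k, DifferentiableOn ℂ f U ∧ DifferentiableOn ℂ g V ∧
    MapsTo f U V ∧ MapsTo g V U ∧ LeftInvOn g f U ∧ RightInvOn g f V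

/-- `Ω` is the union of an increasing sequence of domains, each of which is biholomorphic to the
open unit ball of `ℂ^k`. -/
def IsIncreasingUnionOfBalls {k : ℕ} (Ω : Set (Cn k)) : Prop :=
  ∃ U : ℕ → Set (Cn k), (∀ j, U j ⊆ U (j + 1)) ∧ (∀ j, IsOpen (U j)) ∧
    (∀ j, Biholomorphic (U j) (Metric.ball (0 : Cn k) 1)) ∧ Ω = ⋃ j, U j

/-- The infinitesimal Kobayashi (pseudo-)metric of `Ω` at the point `p` in the direction `ξ`: the
infimum of `1 / R` over all `R > 0` for which some holomorphic map `f` from the open unit disc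
to `Ω` has `f 0 = p` and `f' 0 = R ξ`. -/
def kobayashiMetric {k : ℕ} (Ω : Set (Cn k)) (p ξ : Cn k) : ℝ≥0∞ :=
  sInf {c : ℝ≥0∞ | ∃ (R : ℝ) (f : ℂ → Cn k), 0 < R ∧
    DifferentiableOn ℂ f (Metric.ball 0 1) ∧ MapsTo f (Metric.ball 0 1) Ω ∧
    f 0 = p ∧ deriv f 0 = (R : ℂ) • ξ ∧ c = ENNReal.ofReal (1 / R)}

/-- A real-valued (i.e. nowhere `-∞`) function `u` is plurisubharmonic on the open set `Ω`: it is
upper semicontinuous, and it satisfies the sub-mean value inequality on every closed affine complex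
disc `{z + ζ w : |ζ| ≤ 1}` contained in `Ω`. Since `u z` is finite, the inequality includes that
the mean over the circle is not `-∞`, i.e. that `u` is integrable there. -/
def IsPSHOn {k : ℕ} (u : Cn k → ℝ) (Ω : Set (Cn k)) : Prop :=
  UpperSemicontinuousOn u Ω ∧
    ∀ z w : Cn k, (∀ ζ : ℂ, ‖ζ‖ ≤ 1 → z + ζ • w ∈ Ω) →
      CircleIntegrable (fun ζ : ℂ => u (z + ζ • w)) 0 1 ∧
        u z ≤ Real.circleAverage (fun ζ : ℂ => u (z + ζ • w)) 0 1

/-- A Short `ℂ^k`: a proper subdomain of `ℂ^k` that is an increasing union of domains biholomorphic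
to the ball, whose infinitesimal Kobayashi metric vanishes identically, and which carries a bounded
non-constant plurisubharmonic function (so that it is not biholomorphic to `ℂ^k`). -/
structure IsShortCk {k : ℕ} (Ω : Set (Cn k)) : Prop where
  isOpen : IsOpen Ω
  isConnected : IsConnected Ω
  ne_univ : Ω ≠ univ
  union_of_balls : IsIncreasingUnionOfBalls Ω
  kobayashi_zero : ∀ p ∈ Ω, ∀ ξ : Cn k, kobayashiMetric Ω p ξ = 0
  exists_psh : ∃ u : Cn k → ℝ, IsPSHOn u Ω ∧ (∃ m M : ℝ, ∀ z ∈ Ω, m ≤ u z ∧ u z ≤ M) ∧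
    ∃ z ∈ Ω, ∃ w ∈ Ω, u z ≠ u w

end ShortCk

end

/-! ### Sub-mean value inequalities and decreasing limits of plurisubharmonic functions. -/

namespace ShortCk

/-! Write Φ_n = F_n ∘ ⋯ ∘ F_0. Since |F_n(w)| ≤ |w|^d + |η_n||w| and η_n → 0, all late F_n halve the
norm on one fixed ball B. The basin is therefore the increasing union of the sets Φ_n⁻¹(B), and each
Φ_n is an automorphism; this gives openness, connectedness and the exhaustion by balls
(`EventuallyHalving.basin_eq`). It also kills the Kobayashi metric: Φ_n contracts a neighbourhood of
p at a geometric rate, so a straight disc through Φ_n(p) with velocity R·dΦ_n(ξ) fits in B for large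
n, and its pullback has velocity Rξ at p (`EventuallyHalving.exists_disc`).

For ψ, the decay |η_n| ≤ a^(d^n) matches the degree d. With M_n = max(|Φ_n|, a^(d^n)) one gets
M_{n+1} ≤ 2 M_n^d, so d⁻ⁿ log(2 M_n) decreases to a plurisubharmonic ψ ≥ log a
(`antitone_potential`, `isPSHOn_univ_iInf`), and ψ < 0 cuts out the basin. At the origin ψ = log a.
At a point whose second coordinate eventually dominates the perturbations η_n, that coordinate
decays more slowly than a^(d^n), so ψ is larger there (`exists_mem_basin_lt_iInf_potential`).
Finally, an orbit with large second coordinate never returns to 0. -/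

theorem IsPSHOn.mono {k : ℕ} {u : Cn k → ℝ} {U V : Set (Cn k)} (h : IsPSHOn u V) (hUV : U ⊆ V) :
    IsPSHOn u U :=
  ⟨h.1.mono hUV, fun z w hz => h.2 z w fun ζ hζ => hUV (hz ζ hζ)⟩

/-- The sub-mean value inequality for `log |f|` with `f` entire. -/
theorem log_norm_le_circleAverage {f : ℂ → ℂ} (hf : Differentiable ℂ f) (h0 : f 0 ≠ 0) :
    Real.log ‖f 0‖ ≤ Real.circleAverage (fun ζ => Real.log ‖f ζ‖) 0 1 := by
  have han : AnalyticOnNhd ℂ f (Metric.closedBall 0 |1|) := fun x _ => hf.analyticAt x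
  -- Jensen's formula: the mean exceeds log |f 0| by a sum over the zeros u in the disc of
  -- multiplicity times log (1/|u|), all terms being nonnegative. The term at u = 0 vanishes by the
  -- conventions for `⁻¹` and `Real.log` at 0.
  rw [han.circleAverage_log_norm one_ne_zero h0]
  refine le_add_of_nonneg_left (finsum_nonneg fun u => ?_)
  by_cases hu : u ∈ Metric.closedBall (0 : ℂ) |1|
  · refine mul_nonneg ?_ ?_
    · exact_mod_cast MeromorphicOn.AnalyticOnNhd.divisor_nonneg han u
    · have hu1 : ‖u‖ ≤ 1 := by simpa using hu
      rcases eq_or_ne u 0 with rfl | hu0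
      · simp
      · rw [one_mul, zero_sub, norm_neg]
        exact Real.log_nonneg ((one_le_inv₀ (norm_pos_iff.2 hu0)).2 hu1)
  · rw [Function.locallyFinsuppWithin.apply_eq_zero_of_notMem _ hu]
    simp

/-- The sub-mean value inequality for `log max(|f|, ε)` with `f` entire and vector-valued. -/
theorem log_max_norm_le_circleAverage {E : Type*} [NormedAddCommGroup E] [NormedSpace ℂ E]
    {f : ℂ → E} (hf : Differentiable ℂ f) {ε : ℝ} (hε : 0 < ε) :
    Real.log (max ‖f 0‖ ε) ≤ Real.circleAverage (fun ζ => Real.log (max ‖f ζ‖ ε)) 0 1 := by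
  have hpos : ∀ ζ, 0 < max ‖f ζ‖ ε := fun ζ => lt_max_of_lt_right hε
  have hcont : Continuous fun ζ => Real.log (max ‖f ζ‖ ε) :=
    (hf.continuous.norm.max continuous_const).log fun ζ => (hpos ζ).ne'
  have hint : CircleIntegrable (fun ζ => Real.log (max ‖f ζ‖ ε)) 0 1 :=
    hcont.continuousOn.circleIntegrable zero_le_one
  rcases le_or_gt ‖f 0‖ ε with h | h
  · rw [max_eq_right h]
    calc Real.log ε = Real.circleAverage (fun _ => Real.log ε) 0 1 :=
          (Real.circleAverage_const _ _ _).symm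
      _ ≤ _ := Real.circleAverage_mono (circleIntegrable_const _ _ _) hint
          fun ζ _ => Real.log_le_log hε (le_max_right _ _)
  · rw [max_eq_left h.le]
    have hf0 : 0 < ‖f 0‖ := hε.trans h
    -- A norming functional at `f 0` reduces to the scalar case. Dividing by ε makes the upper bound
    -- for log |q| nonnegative, so the convention log 0 = 0 at zeros of `q` is harmless.
    obtain ⟨g, hg1, hg0⟩ := exists_dual_vector'' ℂ (f 0)
    set q : ℂ → ℂ := fun ζ => (ε : ℂ)⁻¹ * g (f ζ) with hq
    have hqd : Differentiable ℂ q := (g.differentiable.comp hf).const_mul _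
    have hq0 : ‖q 0‖ = ε⁻¹ * ‖f 0‖ := by
      simp [hq, hg0, abs_of_pos hε]
    have hqne : q 0 ≠ 0 := by
      rw [← norm_pos_iff, hq0]; positivity
    have hqle : ∀ ζ, Real.log ‖q ζ‖ ≤ Real.log (max ‖f ζ‖ ε) - Real.log ε := by
      intro ζ
      have h1 : ‖q ζ‖ ≤ ε⁻¹ * max ‖f ζ‖ ε := by
        have : ‖g (f ζ)‖ ≤ ‖f ζ‖ := by
          simpa using g.le_of_opNorm_le hg1 (f ζ)
        simp only [hq, norm_mul, norm_inv, Complex.norm_real, Real.norm_eq_abs, abs_of_pos hε]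
        gcongr
        exact this.trans (le_max_left _ _)
      have h2 : Real.log (max ‖f ζ‖ ε) - Real.log ε = Real.log (ε⁻¹ * max ‖f ζ‖ ε) := by
        rw [Real.log_mul (inv_ne_zero hε.ne') (hpos ζ).ne', Real.log_inv]; ring
      rw [h2]
      rcases eq_or_ne (q ζ) 0 with h3 | h3
      · rw [h3, norm_zero, Real.log_zero]
        refine Real.log_nonneg ?_
        rw [inv_mul_eq_div, one_le_div hε]
        exact le_max_right _ _
      · exact Real.log_le_log (norm_pos_iff.2 h3) h1
    have hqint : CircleIntegrable (fun ζ => Real.log ‖q ζ‖) 0 1 :=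
      MeromorphicOn.circleIntegrable_log_norm fun x _ => (hqd.analyticAt x).meromorphicAt
    have key := (log_norm_le_circleAverage hqd hqne).trans
      (Real.circleAverage_mono hqint (hint.sub (circleIntegrable_const (Real.log ε) _ _))
        fun ζ _ => hqle ζ)
    rw [hq0, Real.log_mul (inv_ne_zero hε.ne') hf0.ne', Real.log_inv,
      Real.circleAverage_sub hint (circleIntegrable_const _ _ _), Real.circleAverage_const] at key
    linarith

/-- A decreasing limit of continuous plurisubharmonic functions that are uniformly bounded below
is plurisubharmonic. -/
theorem isPSHOn_univ_iInf {k : ℕ} {u : ℕ → Cn k → ℝ} (hc : ∀ n, Continuous (u n))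
    (hu : ∀ n, IsPSHOn (u n) univ) (hanti : ∀ z, Antitone fun n => u n z) {m : ℝ}
    (hm : ∀ n z, m ≤ u n z) : IsPSHOn (fun z => ⨅ n, u n z) univ := by
  have hbdd : ∀ z, BddBelow (range fun n => u n z) := fun z =>
    ⟨m, by rintro _ ⟨n, rfl⟩; exact hm n z⟩
  refine ⟨?_, fun z w _ => ?_⟩
  · rw [upperSemicontinuousOn_univ_iff]
    intro z y hy
    obtain ⟨n, hn⟩ := exists_lt_of_ciInf_lt hy
    filter_upwards [(hc n).continuousAt.eventually_lt continuousAt_const hn] with x hx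
    exact (ciInf_le (hbdd x) n).trans_lt hx
  · set v : ℕ → ℝ → ℝ := fun n θ => u n (z + circleMap 0 1 θ • w) with hv
    have hvc : ∀ n, Continuous (v n) := fun n =>
      (hc n).comp (continuous_const.add ((continuous_circleMap 0 1).smul continuous_const))
    have hlim : ∀ θ, Tendsto (fun n => v n θ) atTop (𝓝 (⨅ n, v n θ)) := fun θ =>
      tendsto_atTop_ciInf (hanti _) (hbdd _)
    -- All `v n` lie between m and `v 0`, which provides a continuous dominating function.
    have hbound : ∀ n θ, ‖v n θ‖ ≤ |m| + |v 0 θ| := by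
      intro n θ
      have h1 : v n θ ≤ v 0 θ := hanti _ (Nat.zero_le n)
      have h2 : m ≤ v n θ := hm n _
      rw [Real.norm_eq_abs, abs_le]
      constructor
      · linarith [neg_abs_le m, abs_nonneg (v 0 θ)]
      · linarith [le_abs_self (v 0 θ), abs_nonneg m]
    have hboundc : Continuous fun θ => |m| + |v 0 θ| := continuous_const.add (hvc 0).abs
    have hmeas : Measurable fun θ => ⨅ n, v n θ :=
      measurable_of_tendsto_metrizable (fun n => (hvc n).measurable) (tendsto_pi_nhds.2 hlim)
    have hint : CircleIntegrable (fun ζ : ℂ => ⨅ n, u n (z + ζ • w)) 0 1 := by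
      refine (hboundc.intervalIntegrable 0 (2 * Real.pi)).mono_fun hmeas.aestronglyMeasurable ?_
      refine Eventually.of_forall fun θ => ?_
      have : ‖⨅ n, v n θ‖ ≤ |m| + |v 0 θ| :=
        le_of_tendsto (hlim θ).norm (Eventually.of_forall fun n => hbound n θ)
      exact this.trans (le_abs_self _)
    refine ⟨hint, ?_⟩
    have hav : Tendsto (fun n => Real.circleAverage (fun ζ : ℂ => u n (z + ζ • w)) 0 1) atTop
        (𝓝 (Real.circleAverage (fun ζ : ℂ => ⨅ n, u n (z + ζ • w)) 0 1)) := by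
      refine Tendsto.const_smul ?_ _
      refine intervalIntegral.tendsto_integral_filter_of_dominated_convergence
        (fun θ => |m| + |v 0 θ|) (Eventually.of_forall fun n => (hvc n).aestronglyMeasurable)
        (Eventually.of_forall fun n => Eventually.of_forall fun θ _ => hbound n θ)
        (hboundc.intervalIntegrable _ _) (Eventually.of_forall fun θ _ => hlim θ)
    exact ge_of_tendsto hav (Eventually.of_forall fun n =>
      (ciInf_le (hbdd z) n).trans ((hu n).2 z w fun _ _ => mem_univ _).2)

end ShortCk

namespace ShortCk

/-! ### Non-autonomous basins of contracting sequences of automorphisms -/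

/-- The composition `G_0 ∘ ⋯ ∘ G_n`, inverse to `compUpTo F n` if each `G_j` inverts `F_j`. -/
def compInvUpTo {X : Type*} (G : ℕ → X → X) : ℕ → X → X
  | 0 => G 0
  | n + 1 => compInvUpTo G n ∘ G (n + 1)

theorem leftInverse_compInvUpTo {X : Type*} {F G : ℕ → X → X}
    (h : ∀ n, Function.LeftInverse (G n) (F n)) (n : ℕ) :
    Function.LeftInverse (compInvUpTo G n) (compUpTo F n) := by
  induction n with
  | zero => exact h 0
  | succ n ih => exact (h (n + 1)).comp ih

theorem rightInverse_compInvUpTo {X : Type*} {F G : ℕ → X → X}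
    (h : ∀ n, Function.RightInverse (G n) (F n)) (n : ℕ) :
    Function.RightInverse (compInvUpTo G n) (compUpTo F n) := by
  induction n with
  | zero => exact h 0
  | succ n ih => exact (h (n + 1)).comp ih

theorem differentiable_compUpTo {k : ℕ} {F : ℕ → Cn k → Cn k}
    (hF : ∀ n, Differentiable ℂ (F n)) (n : ℕ) : Differentiable ℂ (compUpTo F n) := by
  induction n with
  | zero => exact hF 0
  | succ n ih => exact (hF (n + 1)).comp ih

theorem differentiable_compInvUpTo {k : ℕ} {G : ℕ → Cn k → Cn k}
    (hG : ∀ n, Differentiable ℂ (G n)) (n : ℕ) : Differentiable ℂ (compInvUpTo G n) := by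
  induction n with
  | zero => exact hG 0
  | succ n ih => exact ih.comp (hG (n + 1))

/-- From the index `N` on, the maps `F_n` halve the norm on the ball of radius `r`. -/
def EventuallyHalving {k : ℕ} (F : ℕ → Cn k → Cn k) (N : ℕ) (r : ℝ) : Prop :=
  ∀ n, N ≤ n → ∀ w, ‖w‖ < r → ‖F n w‖ ≤ ‖w‖ / 2

/-- The points that the first `N + j + 1` maps send into the ball of radius `r`. -/
def basinPiece {k : ℕ} (F : ℕ → Cn k → Cn k) (N : ℕ) (r : ℝ) (j : ℕ) : Set (Cn k) :=
  compUpTo F (N + j) ⁻¹' Metric.ball 0 r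

section

variable {k : ℕ} {F G : ℕ → Cn k → Cn k} {N : ℕ} {r : ℝ}

theorem EventuallyHalving.norm_compUpTo_le (h : EventuallyHalving F N r) {n : ℕ} (hn : N ≤ n)
    {z : Cn k} (hz : ‖compUpTo F n z‖ < r) (m : ℕ) :
    ‖compUpTo F (n + m) z‖ ≤ ‖compUpTo F n z‖ / 2 ^ m := by
  induction m with
  | zero => simp
  | succ m ih =>
    have hlt : ‖compUpTo F (n + m) z‖ < r :=
      (ih.trans (div_le_self (norm_nonneg _) (one_le_pow₀ one_le_two))).trans_lt hz
    calc ‖compUpTo F (n + (m + 1)) z‖ ≤ ‖compUpTo F (n + m) z‖ / 2 :=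
          h (n + m + 1) (by omega) _ hlt
      _ ≤ ‖compUpTo F n z‖ / 2 ^ m / 2 := by gcongr
      _ = _ := by rw [pow_succ, div_div]

theorem EventuallyHalving.basinPiece_subset (h : EventuallyHalving F N r) (j : ℕ) :
    basinPiece F N r j ⊆ basinPiece F N r (j + 1) := by
  intro z hz
  simp only [basinPiece, mem_preimage, mem_ball_zero_iff] at hz ⊢
  have := h.norm_compUpTo_le (Nat.le_add_right N j) hz 1
  rw [pow_one] at this
  exact this.trans_lt ((half_le_self (norm_nonneg _)).trans_lt hz)

/-- An orbit tending to 0 is in the ball at some time past `N`; conversely, once it is there at such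
a time, it decays geometrically. -/
theorem EventuallyHalving.basin_eq (h : EventuallyHalving F N r) (hr : 0 < r) :
    basin F = ⋃ j, basinPiece F N r j := by
  ext z
  simp only [basin, mem_ofPred_eq, mem_iUnion, basinPiece, mem_preimage, mem_ball_zero_iff]
  constructor
  · intro hz
    have h1 : ∀ᶠ n in atTop, ‖compUpTo F n z‖ < r := by
      simpa using hz.norm.eventually_lt_const (by simpa using hr)
    obtain ⟨n, hn, hnN⟩ := (h1.and (eventually_ge_atTop N)).exists
    exact ⟨n - N, by rwa [Nat.add_sub_cancel' hnN]⟩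
  · rintro ⟨j, hj⟩
    rw [← tendsto_add_atTop_iff_nat (N + j)]
    refine squeeze_zero_norm
      (a := fun m => ‖compUpTo F (N + j) z‖ / 2 ^ m) (fun m => ?_) ?_
    · rw [add_comm m]
      exact h.norm_compUpTo_le (Nat.le_add_right N j) hj m
    · exact tendsto_const_nhds.div_atTop (tendsto_pow_atTop_atTop_of_one_lt one_lt_two)

theorem isOpen_basinPiece (hF : ∀ n, Differentiable ℂ (F n)) (j : ℕ) :
    IsOpen (basinPiece F N r j) :=
  Metric.isOpen_ball.preimage (differentiable_compUpTo hF _).continuous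

theorem biholomorphic_basinPiece (hF : ∀ n, Differentiable ℂ (F n))
    (hG : ∀ n, Differentiable ℂ (G n)) (hl : ∀ n, Function.LeftInverse (G n) (F n))
    (hrt : ∀ n, Function.RightInverse (G n) (F n)) (hr : 0 < r) (j : ℕ) :
    Biholomorphic (basinPiece F N r j) (Metric.ball (0 : Cn k) 1) := by
  have hrc : (r : ℂ) ≠ 0 := by exact_mod_cast hr.ne'
  have hL := leftInverse_compInvUpTo hl (N + j)
  have hR := rightInverse_compInvUpTo hrt (N + j)
  refine ⟨fun z => (r : ℂ)⁻¹ • compUpTo F (N + j) z,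
    fun w => compInvUpTo G (N + j) ((r : ℂ) • w),
    ((differentiable_compUpTo hF _).fun_const_smul _).differentiableOn,
    ((differentiable_compInvUpTo hG _).comp (differentiable_id.fun_const_smul _)).differentiableOn,
    fun z hz => ?_, fun w hw => ?_, fun z _ => ?_, fun w _ => ?_⟩
  · simp only [basinPiece, mem_preimage, mem_ball_zero_iff] at hz ⊢
    rw [norm_smul, norm_inv, Complex.norm_real, Real.norm_of_nonneg hr.le, inv_mul_eq_div,
      div_lt_one hr]
    exact hz
  · simp only [basinPiece, mem_preimage, mem_ball_zero_iff] at hw ⊢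
    rw [hR, norm_smul, Complex.norm_real, Real.norm_of_nonneg hr.le]
    exact mul_lt_of_lt_one_right hr hw
  · simp only [smul_inv_smul₀ hrc, hL z]
  · simp only [hR _, inv_smul_smul₀ hrc]

theorem isConnected_basinPiece (hG : ∀ n, Differentiable ℂ (G n))
    (hl : ∀ n, Function.LeftInverse (G n) (F n)) (hrt : ∀ n, Function.RightInverse (G n) (F n))
    (hr : 0 < r) (j : ℕ) : IsConnected (basinPiece F N r j) := by
  have : basinPiece F N r j = compInvUpTo G (N + j) '' Metric.ball 0 r :=
    (image_eq_preimage_of_inverse (rightInverse_compInvUpTo hrt _)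
      (leftInverse_compInvUpTo hl _) ▸ rfl)
  rw [this]
  have hball : IsConnected (Metric.ball (0 : Cn k) r) :=
    (convex_ball 0 r).isConnected ⟨0, Metric.mem_ball_self hr⟩
  exact hball.image _ (differentiable_compInvUpTo hG _).continuous.continuousOn

theorem EventuallyHalving.isConnected_basin (h : EventuallyHalving F N r)
    (hG : ∀ n, Differentiable ℂ (G n)) (hl : ∀ n, Function.LeftInverse (G n) (F n))
    (hrt : ∀ n, Function.RightInverse (G n) (F n)) (hr : 0 < r) : IsConnected (basin F) := by
  rw [h.basin_eq hr]
  have hmono : Monotone (basinPiece F N r) := monotone_nat_of_le_succ h.basinPiece_subset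
  obtain ⟨x, hx⟩ : (basinPiece F N r 0).Nonempty :=
    (isConnected_basinPiece hG hl hrt hr 0).nonempty
  exact ⟨⟨x, mem_iUnion.2 ⟨0, hx⟩⟩, isPreconnected_iUnion
    ⟨x, mem_iInter.2 fun j => hmono (Nat.zero_le j) hx⟩
    fun j => (isConnected_basinPiece hG hl hrt hr j).isPreconnected⟩

theorem EventuallyHalving.isOpen_basin (h : EventuallyHalving F N r)
    (hF : ∀ n, Differentiable ℂ (F n)) (hr : 0 < r) : IsOpen (basin F) := by
  rw [h.basin_eq hr]
  exact isOpen_iUnion fun j => isOpen_basinPiece hF j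

theorem EventuallyHalving.isIncreasingUnionOfBalls_basin (h : EventuallyHalving F N r)
    (hF : ∀ n, Differentiable ℂ (F n))
    (hG : ∀ n, Differentiable ℂ (G n)) (hl : ∀ n, Function.LeftInverse (G n) (F n))
    (hrt : ∀ n, Function.RightInverse (G n) (F n)) (hr : 0 < r) :
    IsIncreasingUnionOfBalls (basin F) :=
  ⟨basinPiece F N r, h.basinPiece_subset, isOpen_basinPiece hF,
    biholomorphic_basinPiece hF hG hl hrt hr, h.basin_eq hr⟩

/-- Discs of arbitrary size in the basin: `F_n ∘ ⋯ ∘ F_0` has a small derivative at `p`, and a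
straight disc in the ball of radius `r` is pulled back by it. -/
theorem EventuallyHalving.exists_disc (h : EventuallyHalving F N r)
    (hF : ∀ n, Differentiable ℂ (F n))
    (hG : ∀ n, Differentiable ℂ (G n)) (hl : ∀ n, Function.LeftInverse (G n) (F n))
    (hrt : ∀ n, Function.RightInverse (G n) (F n)) (hr : 0 < r) {p : Cn k} (hp : p ∈ basin F)
    (ξ : Cn k) {R : ℝ} (hR : 0 < R) :
    ∃ f : ℂ → Cn k, DifferentiableOn ℂ f (Metric.ball 0 1) ∧
      MapsTo f (Metric.ball 0 1) (basin F) ∧ f 0 = p ∧ deriv f 0 = (R : ℂ) • ξ := by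
  rw [h.basin_eq hr] at hp ⊢
  obtain ⟨j, hj⟩ := mem_iUnion.1 hp
  set line : ℂ → Cn k := fun ζ => p + ζ • ξ with hline
  have hlined : Differentiable ℂ line := by fun_prop
  obtain ⟨ε, hε, hεj⟩ : ∃ ε > 0, ∀ ζ : ℂ, ‖ζ‖ ≤ ε → line ζ ∈ basinPiece F N r j := by
    have : line ⁻¹' basinPiece F N r j ∈ 𝓝 (0 : ℂ) :=
      hlined.continuous.continuousAt.preimage_mem_nhds
        ((isOpen_basinPiece hF j).mem_nhds (by simpa [hline] using hj))
    obtain ⟨ε, hε, hs⟩ := Metric.nhds_basis_closedBall.mem_iff.1 this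
    exact ⟨ε, hε, fun ζ hζ => hs (by simpa using hζ)⟩
  -- The two summands will bound the centre of the straight disc and, by Cauchy's estimate on the
  -- disc of radius ε, its radius.
  obtain ⟨m, hm⟩ : ∃ m : ℕ, r / 2 ^ m * (1 + R / ε) < r := by
    have ht : Tendsto (fun m : ℕ => r / 2 ^ m * (1 + R / ε)) atTop (𝓝 (0 * (1 + R / ε))) :=
      (tendsto_const_nhds.div_atTop
        (tendsto_pow_atTop_atTop_of_one_lt one_lt_two)).mul_const _
    rw [zero_mul] at ht
    exact (ht.eventually_lt_const hr).exists
  set n := N + j + m with hn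
  set q : ℂ → Cn k := fun ζ => compUpTo F n (line ζ) with hq
  have hqd : Differentiable ℂ q := (differentiable_compUpTo hF n).comp hlined
  have hqle : ∀ ζ : ℂ, ‖ζ‖ ≤ ε → ‖q ζ‖ ≤ r / 2 ^ m := by
    intro ζ hζ
    have h1 : ‖compUpTo F (N + j) (line ζ)‖ < r := by
      simpa [basinPiece] using hεj ζ hζ
    exact (h.norm_compUpTo_le (Nat.le_add_right N j) h1 m).trans (by gcongr)
  have hderiv : ‖deriv q 0‖ ≤ r / 2 ^ m / ε :=
    Complex.norm_deriv_le_of_forall_mem_sphere_norm_le hε hqd.diffContOnCl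
      fun ζ hζ => hqle ζ (by simpa using (mem_sphere_zero_iff_norm.1 hζ).le)
  set g : ℂ → Cn k := fun ζ => q 0 + ζ • ((R : ℂ) • deriv q 0) with hg
  have hgd : Differentiable ℂ g := by fun_prop
  have hGd := differentiable_compInvUpTo hG n
  refine ⟨fun ζ => compInvUpTo G n (g ζ), (hGd.comp hgd).differentiableOn, fun ζ hζ => ?_, ?_, ?_⟩
  · refine mem_iUnion.2 ⟨j + m, ?_⟩
    have hζ1 : ‖ζ‖ ≤ 1 := (mem_ball_zero_iff.1 hζ).le
    simp only [basinPiece, mem_preimage, mem_ball_zero_iff, ← add_assoc, ← hn]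
    rw [rightInverse_compInvUpTo hrt n]
    calc ‖g ζ‖ ≤ ‖q 0‖ + ‖ζ‖ * (R * ‖deriv q 0‖) := by
          refine (norm_add_le _ _).trans_eq ?_
          rw [norm_smul, norm_smul, Complex.norm_real, Real.norm_of_nonneg hR.le]
      _ ≤ r / 2 ^ m + 1 * (R * (r / 2 ^ m / ε)) := by
          gcongr
          exact hqle 0 (by simpa using hε.le)
      _ = r / 2 ^ m * (1 + R / ε) := by ring
      _ < r := hm
  · simp [hg, hq, hline, leftInverse_compInvUpTo hl n p]
  · have hg' : HasDerivAt g ((R : ℂ) • deriv q 0) 0 := by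
      simpa only [one_smul] using
        ((hasDerivAt_id' (0 : ℂ)).smul_const ((R : ℂ) • deriv q 0)).const_add (q 0)
    have hG0 : HasFDerivAt (compInvUpTo G n) (fderiv ℂ (compInvUpTo G n) (q 0)) (q 0) :=
      (hGd _).hasFDerivAt
    have hg0 : g 0 = q 0 := by simp [hg]
    have h1 : HasDerivAt (fun ζ => compInvUpTo G n (g ζ))
        (fderiv ℂ (compInvUpTo G n) (q 0) ((R : ℂ) • deriv q 0)) 0 :=
      HasFDerivAt.comp_hasDerivAt (0 : ℂ) (hg0.symm ▸ hG0) hg'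
    -- The inverse composed with `q` is the original line, so the derivative of the inverse sends
    -- `deriv q 0` to ξ.
    have h2 : HasDerivAt (fun ζ => compInvUpTo G n (q ζ))
        (fderiv ℂ (compInvUpTo G n) (q 0) (deriv q 0)) 0 :=
      HasFDerivAt.comp_hasDerivAt (0 : ℂ) hG0 (hqd 0).hasDerivAt
    have h3 : (fun ζ => compInvUpTo G n (q ζ)) = line :=
      funext fun ζ => leftInverse_compInvUpTo hl n _
    have h4 : HasDerivAt line ξ 0 := by
      simpa only [one_smul] using ((hasDerivAt_id' (0 : ℂ)).smul_const ξ).const_add p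
    rw [h3] at h2
    rw [h1.deriv, map_smul, h2.unique h4]

theorem EventuallyHalving.kobayashiMetric_basin (h : EventuallyHalving F N r)
    (hF : ∀ n, Differentiable ℂ (F n))
    (hG : ∀ n, Differentiable ℂ (G n)) (hl : ∀ n, Function.LeftInverse (G n) (F n))
    (hrt : ∀ n, Function.RightInverse (G n) (F n)) (hr : 0 < r) {p : Cn k} (hp : p ∈ basin F)
    (ξ : Cn k) : kobayashiMetric (basin F) p ξ = 0 := by
  have hle : ∀ n : ℕ, kobayashiMetric (basin F) p ξ ≤ ENNReal.ofReal (1 / ((n : ℝ) + 1)) := by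
    intro n
    have hn : (0 : ℝ) < n + 1 := by positivity
    obtain ⟨f, hf1, hf2, hf3, hf4⟩ := h.exists_disc hF hG hl hrt hr hp ξ hn
    exact sInf_le ⟨_, f, hn, hf1, hf2, hf3, hf4, rfl⟩
  have ht : Tendsto (fun n : ℕ => ENNReal.ofReal (1 / ((n : ℝ) + 1))) atTop (𝓝 0) := by
    simpa using ENNReal.tendsto_ofReal tendsto_one_div_add_atTop_nhds_zero_nat
  exact le_antisymm (ge_of_tendsto' ht hle) bot_le

end

end ShortCk

namespace ShortCk

/-! ### The shift maps -/

theorem shiftMap_apply_zero {k : ℕ} (d : ℕ) (η : ℂ) (z : Cn k) (hk : 0 < k) :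
    shiftMap k d η z ⟨0, hk⟩ = η * z ⟨k - 1, Nat.sub_lt hk one_pos⟩ := by
  simp [shiftMap]

theorem shiftMap_apply_succ {k : ℕ} (d : ℕ) (η : ℂ) (z : Cn k) {i : ℕ} (hi : i + 1 < k) :
    shiftMap k d η z ⟨i + 1, hi⟩ = z ⟨i + 1, hi⟩ ^ d + η * z ⟨i, by omega⟩ := by
  simp [shiftMap]

theorem differentiable_shiftMap (k d : ℕ) (η : ℂ) : Differentiable ℂ (shiftMap k d η) := by
  rw [differentiable_euclidean]
  rintro ⟨i, hi⟩
  cases i with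
  | zero => simp only [shiftMap_apply_zero]; fun_prop
  | succ i => simp only [shiftMap_apply_succ]; fun_prop

/-- The coordinate of index `k - 1 - j` of the preimage of `u` under the shift map. -/
noncomputable def shiftInvCoord {k : ℕ} (hk : 0 < k) (d : ℕ) (η : ℂ) (u : Cn k) : ℕ → ℂ
  | 0 => u ⟨0, hk⟩ / η
  | j + 1 => (u ⟨k - 1 - j, by omega⟩ - shiftInvCoord hk d η u j ^ d) / η

/-- The inverse of the shift map. -/
noncomputable def shiftInv {k : ℕ} (hk : 0 < k) (d : ℕ) (η : ℂ) (u : Cn k) : Cn k :=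
  WithLp.toLp 2 fun i : Fin k => shiftInvCoord hk d η u (k - 1 - i)

theorem differentiable_shiftInv {k : ℕ} (hk : 0 < k) (d : ℕ) (η : ℂ) :
    Differentiable ℂ (shiftInv hk d η) := by
  rw [differentiable_euclidean]
  intro i
  change Differentiable ℂ fun u => shiftInvCoord hk d η u (k - 1 - i)
  induction k - 1 - (i : ℕ) with
  | zero => simp only [shiftInvCoord]; fun_prop
  | succ j ih => simp only [shiftInvCoord]; fun_prop

/-- The system is triangular: the first component of the image determines the last coordinate, and
each further component, read from the last one downwards, determines the preceding coordinate. -/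
theorem leftInverse_shiftInv {k : ℕ} (hk : 0 < k) (d : ℕ) {η : ℂ} (hη : η ≠ 0) :
    Function.LeftInverse (shiftInv hk d η) (shiftMap k d η) := by
  intro z
  have key : ∀ j (hj : j < k), shiftInvCoord hk d η (shiftMap k d η z) j
      = z ⟨k - 1 - j, by omega⟩ := by
    intro j
    induction j with
    | zero =>
      intro _
      simp only [shiftInvCoord, shiftMap_apply_zero]
      exact mul_div_cancel_left₀ _ hη
    | succ j ih =>
      intro hj
      obtain ⟨i, hi⟩ : ∃ i, k - 1 - j = i + 1 := ⟨k - 1 - j - 1, by omega⟩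
      have hi' : k - 1 - (j + 1) = i := by omega
      simp only [shiftInvCoord, ih (by omega), hi, hi', shiftMap_apply_succ, add_sub_cancel_left]
      exact mul_div_cancel_left₀ _ hη
  ext i
  change shiftInvCoord hk d η (shiftMap k d η z) (k - 1 - i) = z i
  rw [key _ (by omega)]
  have hi : k - 1 - (k - 1 - (i : ℕ)) = i := by omega
  simp only [hi]

theorem rightInverse_shiftInv {k : ℕ} (hk : 0 < k) (d : ℕ) {η : ℂ} (hη : η ≠ 0) :
    Function.RightInverse (shiftInv hk d η) (shiftMap k d η) := by
  intro u
  have hcoord : ∀ i (hi : i < k), shiftInv hk d η u ⟨i, hi⟩ = shiftInvCoord hk d η u (k - 1 - i) :=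
    fun _ _ => rfl
  ext ⟨i, hi⟩
  cases i with
  | zero =>
    rw [shiftMap_apply_zero, hcoord, Nat.sub_self, shiftInvCoord]
    exact mul_div_cancel₀ _ hη
  | succ i =>
    have h1 : k - 1 - i = (k - 1 - (i + 1)) + 1 := by omega
    have h2 : k - 1 - (k - 1 - (i + 1)) = i + 1 := by omega
    rw [shiftMap_apply_succ, hcoord, hcoord, h1, shiftInvCoord, mul_div_cancel₀ _ hη]
    simp only [h2, add_sub_cancel]

theorem shiftMap_zero (k : ℕ) {d : ℕ} (hd : d ≠ 0) (η : ℂ) : shiftMap k d η 0 = 0 := by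
  ext i
  simp [shiftMap, hd]

/-- The map is a power part plus η times a cyclic permutation of the coordinates. The permutation is
an isometry, and |z_i|^d ≤ |z|^(d-1) |z_i| bounds the power part in the Euclidean norm. -/
theorem norm_shiftMap_le (k : ℕ) {d : ℕ} (hd : d ≠ 0) (η : ℂ) (z : Cn k) :
    ‖shiftMap k d η z‖ ≤ ‖z‖ ^ d + ‖η‖ * ‖z‖ := by
  obtain ⟨e, rfl⟩ := Nat.exists_eq_succ_of_ne_zero hd
  set σ : Fin k → Fin k := fun i =>
    if i.val = 0 then ⟨k - 1, Nat.sub_lt i.pos one_pos⟩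
    else ⟨i.val - 1, (Nat.sub_le _ _).trans_lt i.isLt⟩ with hσ
  have hσi : Function.Injective σ := by
    intro i j hij
    have := congrArg Fin.val hij
    simp only [hσ] at this
    ext
    split_ifs at this <;> simp only at this <;> omega
  set p : Cn k := WithLp.toLp 2 fun i : Fin k => if i.val = 0 then 0 else z i ^ (e + 1) with hp
  set s : Cn k := WithLp.toLp 2 fun i : Fin k => z (σ i) with hs
  have hsum : shiftMap k (e + 1) η z = p + η • s := by
    ext i
    simp only [shiftMap, hp, hs, hσ, PiLp.add_apply, PiLp.smul_apply, smul_eq_mul]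
    split_ifs <;> simp
  have hsn : ‖s‖ = ‖z‖ := by
    rw [EuclideanSpace.norm_eq, EuclideanSpace.norm_eq]
    congr 1
    exact Fintype.sum_bijective σ (Finite.injective_iff_bijective.1 hσi) _ _ fun i => rfl
  have hpn : ‖p‖ ≤ ‖z‖ ^ (e + 1) := by
    have h1 : ‖p‖ ^ 2 ≤ (‖z‖ ^ (e + 1)) ^ 2 := by
      calc ‖p‖ ^ 2 = ∑ i, ‖p i‖ ^ 2 := EuclideanSpace.norm_sq_eq p
        _ ≤ ∑ i, (‖z‖ ^ e) ^ 2 * ‖z i‖ ^ 2 := by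
            refine Finset.sum_le_sum fun i _ => ?_
            rw [← mul_pow]
            gcongr
            simp only [hp]
            split_ifs
            · simp only [norm_zero]; positivity
            · rw [norm_pow, pow_succ]
              gcongr
              exact PiLp.norm_apply_le z i
        _ = (‖z‖ ^ (e + 1)) ^ 2 := by
            rw [← Finset.mul_sum, ← EuclideanSpace.norm_sq_eq z, ← mul_pow, pow_succ ‖z‖ e]
    exact (pow_le_pow_iff_left₀ (norm_nonneg _) (by positivity) two_ne_zero).1 h1
  rw [hsum]
  refine (norm_add_le _ _).trans ?_
  rw [norm_smul, hsn]
  gcongr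

theorem compUpTo_shiftMap_zero (k : ℕ) {d : ℕ} (hd : d ≠ 0) (η : ℕ → ℂ) (n : ℕ) :
    compUpTo (fun n => shiftMap k d (η n)) n 0 = 0 := by
  induction n with
  | zero => exact shiftMap_zero k hd _
  | succ n ih =>
    rw [compUpTo, Function.comp_apply, ih]
    exact shiftMap_zero k hd _

theorem eventuallyHalving_shiftMap (k : ℕ) {d : ℕ} (hd : 2 ≤ d) {η : ℕ → ℂ} {N : ℕ}
    (hη : ∀ n, N ≤ n → ‖η n‖ ≤ 1 / 4) :
    EventuallyHalving (fun n => shiftMap k d (η n)) N (1 / 4) := by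
  intro n hn w hw
  have h1 : ‖w‖ ^ d ≤ ‖w‖ ^ 2 := pow_le_pow_of_le_one (norm_nonneg _) (by linarith) hd
  have h2 := norm_shiftMap_le k (by omega : d ≠ 0) (η n) w
  have h3 := hη n hn
  nlinarith [norm_nonneg w, mul_le_mul_of_nonneg_right h3 (norm_nonneg w)]

/-- The basin is not the whole space: the orbit of `(0, 5, 0, …, 0)` stays away from `0`. -/
theorem basin_shiftMap_ne_univ {k d : ℕ} (hk : 2 ≤ k) (hd : 2 ≤ d) {η : ℕ → ℂ}
    (hη : ∀ n, ‖η n‖ ≤ 1) : basin (fun n => shiftMap k d (η n)) ≠ univ := by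
  -- Index 1 is the second coordinate. With x its modulus, its image has modulus at least x^d - x/2,
  -- and the other image coordinates are at most x^d/4 + x. The ratio 1/2 is preserved as soon as
  -- x^d ≥ 5x, hence the threshold 5.
  set Good : Cn k → Prop := fun w =>
    5 ≤ ‖w ⟨1, hk⟩‖ ∧ ∀ i : Fin k, i.val ≠ 1 → ‖w i‖ ≤ ‖w ⟨1, hk⟩‖ / 2 with hGood
  have hstep : ∀ n w, Good w → Good (shiftMap k d (η n) w) := by
    rintro n w ⟨h5, hw⟩
    set x := ‖w ⟨1, hk⟩‖ with hx
    have hxd : x ^ 2 ≤ x ^ d := pow_le_pow_right₀ (by linarith) hd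
    have hη1 := hη n
    have hle : ∀ i, ‖w i‖ ≤ x := by
      intro i
      by_cases hi : i.val = 1
      · exact (congrArg (fun j => ‖w j‖) (Fin.ext hi : i = ⟨1, hk⟩)).le
      · linarith [hw i hi]
    have hmul : ∀ i, ‖η n * w i‖ ≤ ‖w i‖ := fun i => by
      rw [norm_mul]; exact mul_le_of_le_one_left (norm_nonneg _) hη1
    have h1 : x ^ d - x / 2 ≤ ‖shiftMap k d (η n) w ⟨1, hk⟩‖ := by
      have hlow := norm_sub_le_norm_add (w ⟨1, hk⟩ ^ d) (η n * w ⟨0, by omega⟩)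
      have := (hmul ⟨0, by omega⟩).trans (hw ⟨0, by omega⟩ (by simp))
      rw [norm_pow] at hlow
      rw [shiftMap_apply_succ]
      linarith
    refine ⟨by nlinarith, ?_⟩
    rintro ⟨i, hi⟩ hi1
    cases i with
    | zero =>
      rw [shiftMap_apply_zero]
      have := (hmul ⟨k - 1, by omega⟩).trans (hle _)
      nlinarith
    | succ i =>
      rw [shiftMap_apply_succ]
      have ha := norm_add_le (w ⟨i + 1, hi⟩ ^ d) (η n * w ⟨i, by omega⟩)
      have hb := (hmul ⟨i, by omega⟩).trans (hle _)
      have hc : ‖w ⟨i + 1, hi⟩ ^ d‖ ≤ x ^ d / 4 := by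
        rw [norm_pow]
        calc ‖w ⟨i + 1, hi⟩‖ ^ d ≤ (x / 2) ^ d := by
              gcongr; exact hw _ hi1
          _ = x ^ d * (1 / 2) ^ d := by rw [← mul_pow]; ring_nf
          _ ≤ x ^ d * (1 / 2) ^ 2 := by
              gcongr x ^ d * ?_
              exact pow_le_pow_of_le_one (by norm_num) (by norm_num) hd
          _ = x ^ d / 4 := by ring
      nlinarith
  set z : Cn k := EuclideanSpace.single ⟨1, hk⟩ 5 with hz
  have hz0 : Good z := by
    refine ⟨by simp [hz], fun i hi => ?_⟩
    have : i ≠ ⟨1, hk⟩ := fun h => hi (by rw [h])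
    simp only [hz, PiLp.single_apply, this, if_false, norm_zero]
    positivity
  have hall : ∀ n, Good (compUpTo (fun n => shiftMap k d (η n)) n z) := by
    intro n
    induction n with
    | zero => exact hstep 0 _ hz0
    | succ n ih => exact hstep (n + 1) _ ih
  intro huniv
  have hzb : z ∈ basin (fun n => shiftMap k d (η n)) := huniv ▸ mem_univ z
  have hlim : Tendsto (fun n => ‖compUpTo (fun n => shiftMap k d (η n)) n z‖) atTop (𝓝 0) := by
    simpa using (show Tendsto _ _ _ from hzb).norm
  have : (5 : ℝ) ≤ 0 := ge_of_tendsto' hlim fun n => (hall n).1.trans (PiLp.norm_apply_le _ _)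
  norm_num at this

/-! ### The plurisubharmonic function -/

/-- The functions `d⁻ⁿ log (2 max(|F_n ∘ ⋯ ∘ F_0|, a^(d^n)))`, which decrease to a defining
function of the basin. -/
noncomputable def potential {k : ℕ} (F : ℕ → Cn k → Cn k) (d : ℕ) (a : ℝ) (n : ℕ) (z : Cn k) : ℝ :=
  ((d : ℝ) ^ n)⁻¹ * Real.log (2 * max ‖compUpTo F n z‖ (a ^ d ^ n))

section

variable {k d : ℕ} {a : ℝ} {F : ℕ → Cn k → Cn k} {η : ℕ → ℂ}

theorem potential_pos_arg (ha : 0 < a) (n : ℕ) (z : Cn k) :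
    0 < 2 * max ‖compUpTo F n z‖ (a ^ d ^ n) :=
  mul_pos two_pos (lt_max_of_lt_right (by positivity))

theorem continuous_potential (hF : ∀ n, Differentiable ℂ (F n)) (ha : 0 < a) (n : ℕ) :
    Continuous (potential F d a n) :=
  continuous_const.mul ((continuous_const.mul
    ((differentiable_compUpTo hF n).continuous.norm.max continuous_const)).log
      fun z => (potential_pos_arg ha n z).ne')

theorem isPSHOn_potential (hF : ∀ n, Differentiable ℂ (F n)) (ha : 0 < a) (n : ℕ) :
    IsPSHOn (potential F d a n) univ := by
  have hcont := continuous_potential (d := d) hF ha n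
  refine ⟨hcont.upperSemicontinuous.upperSemicontinuousOn _, fun z w _ => ?_⟩
  have hlined : Differentiable ℂ fun ζ : ℂ => z + ζ • w := by fun_prop
  refine ⟨(hcont.comp hlined.continuous).continuousOn.circleIntegrable zero_le_one, ?_⟩
  have hε : 0 < a ^ d ^ n := by positivity
  set f : ℂ → Cn k := fun ζ => compUpTo F n (z + ζ • w) with hf
  have hfd : Differentiable ℂ f := (differentiable_compUpTo hF n).comp hlined
  have hint : CircleIntegrable (fun ζ => Real.log (max ‖f ζ‖ (a ^ d ^ n))) 0 1 :=
    ((hfd.continuous.norm.max continuous_const).log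
      fun ζ => (lt_max_of_lt_right hε).ne').continuousOn.circleIntegrable zero_le_one
  have heq : ∀ ζ : ℂ, potential F d a n (z + ζ • w)
      = ((d : ℝ) ^ n)⁻¹ • (Real.log 2 + Real.log (max ‖f ζ‖ (a ^ d ^ n))) := fun ζ => by
    rw [potential, Real.log_mul two_ne_zero (lt_max_of_lt_right hε).ne', smul_eq_mul]
  have hz : potential F d a n z
      = ((d : ℝ) ^ n)⁻¹ • (Real.log 2 + Real.log (max ‖f 0‖ (a ^ d ^ n))) := by
    simpa using heq 0
  simp only [heq]
  rw [hz, Real.circleAverage_fun_smul,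
    Real.circleAverage_fun_add (circleIntegrable_const _ _ _) hint, Real.circleAverage_const,
    smul_eq_mul, smul_eq_mul]
  gcongr
  exact log_max_norm_le_circleAverage hfd hε

/-- The floor a^(d^n) inside the maximum is there for this bound: it keeps the limit finite even at
the fixed point 0. -/
theorem log_le_potential (hd : 0 < d) (ha : 0 < a) (n : ℕ) (z : Cn k) :
    Real.log a ≤ potential F d a n z := by
  have hdn : (0 : ℝ) < (d : ℝ) ^ n := by positivity
  rw [potential, inv_mul_eq_div, le_div_iff₀ hdn, mul_comm]
  have h1 : (d : ℝ) ^ n * Real.log a = Real.log (a ^ d ^ n) := by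
    rw [Real.log_pow]; push_cast; ring
  have h2 : 0 < a ^ d ^ n := by positivity
  rw [h1]
  refine Real.log_le_log h2 ?_
  linarith [le_max_right ‖compUpTo F n z‖ (a ^ d ^ n)]

theorem potential_neg_iff (hd : 0 < d) (ha : 0 < a) {n : ℕ} {z : Cn k} :
    potential F d a n z < 0 ↔ ‖compUpTo F n z‖ < 1 / 2 ∧ a ^ d ^ n < 1 / 2 := by
  have hdn : (0 : ℝ) < ((d : ℝ) ^ n)⁻¹ := by positivity
  rw [potential, ← mul_zero ((d : ℝ) ^ n)⁻¹, mul_lt_mul_iff_right₀ hdn,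
    Real.log_neg_iff (potential_pos_arg ha n z), ← max_lt_iff]
  constructor <;> intro h <;> linarith

/-- With M the maximum at stage n, the next maximum is at most 2 M^d, and 2 · 2 M^d ≤ (2M)^d because
d ≥ 2. The factor 2 in the potential absorbs the constant in this way. -/
theorem antitone_potential (hd : 2 ≤ d) (ha : 0 < a) (ha1 : a < 1)
    (hη : ∀ n, ‖η n‖ ≤ a ^ d ^ n) (z : Cn k) :
    Antitone fun n => potential (fun n => shiftMap k d (η n)) d a n z := by
  refine antitone_nat_of_succ_le fun n => ?_
  set F : ℕ → Cn k → Cn k := fun n => shiftMap k d (η n)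
  set x := ‖compUpTo F n z‖ with hx
  set M := max x (a ^ d ^ n) with hM
  have hx0 : 0 ≤ x := norm_nonneg _
  have hM0 : 0 < M := lt_max_of_lt_right (by positivity)
  have hbM : a ^ d ^ (n + 1) ≤ M ^ d := by
    rw [pow_succ, pow_mul]
    gcongr
    exact le_max_right _ _
  have hb1 : a ^ d ^ (n + 1) ≤ 1 := pow_le_one₀ ha.le ha1.le
  -- For x ≤ 1 the bound on η suffices, since a^(d^(n+1)) is the d-th power of the floor; for x ≥ 1
  -- one uses |η| ≤ 1 and x ≤ x^d.
  have hηx : ‖η (n + 1)‖ * x ≤ M ^ d := by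
    refine (mul_le_mul_of_nonneg_right (hη (n + 1)) hx0).trans ?_
    rcases le_total x 1 with h | h
    · exact (mul_le_of_le_one_right (by positivity) h).trans hbM
    · calc a ^ d ^ (n + 1) * x ≤ 1 * x := by gcongr
        _ = x ^ 1 := by ring
        _ ≤ x ^ d := pow_le_pow_right₀ h (by omega)
        _ ≤ M ^ d := by gcongr; exact le_max_left _ _
  have hnext : ‖compUpTo F (n + 1) z‖ ≤ 2 * M ^ d := by
    have h1 := norm_shiftMap_le k (by omega : d ≠ 0) (η (n + 1)) (compUpTo F n z)
    have h2 : x ^ d ≤ M ^ d := by gcongr; exact le_max_left _ _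
    change ‖shiftMap k d (η (n + 1)) (compUpTo F n z)‖ ≤ _
    linarith
  have hmax : 2 * max ‖compUpTo F (n + 1) z‖ (a ^ d ^ (n + 1)) ≤ (2 * M) ^ d := by
    have hMd : 0 < M ^ d := by positivity
    have h4 : (2 : ℝ) ^ 2 ≤ 2 ^ d := pow_le_pow_right₀ one_le_two hd
    calc 2 * max ‖compUpTo F (n + 1) z‖ (a ^ d ^ (n + 1)) ≤ 2 * (2 * M ^ d) := by
          gcongr
          exact max_le hnext (by linarith)
      _ = 2 ^ 2 * M ^ d := by ring
      _ ≤ 2 ^ d * M ^ d := by gcongr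
      _ = (2 * M) ^ d := (mul_pow _ _ _).symm
  have hd0 : (d : ℝ) ≠ 0 := by positivity
  calc potential F d a (n + 1) z
      ≤ ((d : ℝ) ^ (n + 1))⁻¹ * Real.log ((2 * M) ^ d) := by
        unfold potential
        gcongr
    _ = potential F d a n z := by
        rw [Real.log_pow, potential, ← hx, ← hM, pow_succ]
        field_simp

theorem tendsto_pow_pow (hd : 2 ≤ d) (ha : 0 < a) (ha1 : a < 1) :
    Tendsto (fun n => a ^ d ^ n) atTop (𝓝 0) :=
  (tendsto_pow_atTop_nhds_zero_of_lt_one ha.le ha1).comp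
    (tendsto_pow_atTop_atTop_of_one_lt (by omega))

/-- A point at which the infimum of the potentials is larger than `log a`, the value at `0`:
the preimage of `(0, 1/8, 0, …, 0)` under a long composition. -/
theorem exists_mem_basin_lt_iInf_potential {G : ℕ → Cn k → Cn k} {N : ℕ} (hk : 2 ≤ k)
    (hd : 2 ≤ d) (ha : 0 < a) (hN : a ^ d ^ N < 1 / 16)
    (hη : ∀ n, ‖η n‖ ≤ a ^ d ^ n)
    (hhalf : EventuallyHalving (fun n => shiftMap k d (η n)) N (1 / 4))
    (hG : ∀ n, Function.RightInverse (G n) (shiftMap k d (η n))) :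
    ∃ w ∈ basin (fun n => shiftMap k d (η n)),
      ∃ c, Real.log a < c ∧ ∀ n, N ≤ n →
        c ≤ potential (fun n => shiftMap k d (η n)) d a n w := by
  set F : ℕ → Cn k → Cn k := fun n => shiftMap k d (η n)
  -- The value 1/8 lies within the halving radius 1/4 and equals 2 · (1/16), the start of the
  -- induction in `hlow`.
  set v : Cn k := EuclideanSpace.single ⟨1, hk⟩ (1 / 8) with hv
  set w := compInvUpTo G N v with hw
  have hFw : compUpTo F N w = v := rightInverse_compInvUpTo (F := F) hG N v
  have hvn : ‖v‖ = 1 / 8 := by simp [hv]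
  have hFwn : ‖compUpTo F N w‖ < 1 / 4 := by rw [hFw, hvn]; norm_num
  have hle1 : ∀ m, ‖compUpTo F (N + m) w‖ ≤ 1 := fun m => by
    refine (hhalf.norm_compUpTo_le le_rfl hFwn m).trans
      ((div_le_self (norm_nonneg _) (one_le_pow₀ one_le_two)).trans ?_)
    linarith
  -- The factor 2 leaves room for the perturbation: raising to the power d gives at least 4s, and
  -- the η-term removes at most s.
  have hlow : ∀ m, 2 * (1 / 16 : ℝ) ^ d ^ m ≤ ‖compUpTo F (N + m) w ⟨1, hk⟩‖ := by
    intro m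
    induction m with
    | zero => simp [hFw, hv]; norm_num
    | succ m ih =>
      set y := compUpTo F (N + m) w with hy
      have hstep : compUpTo F (N + (m + 1)) w ⟨1, hk⟩
          = y ⟨1, hk⟩ ^ d + η (N + m + 1) * y ⟨0, by omega⟩ :=
        shiftMap_apply_succ d (η (N + m + 1)) y hk
      have h1 := norm_sub_le_norm_add (y ⟨1, hk⟩ ^ d) (η (N + m + 1) * y ⟨0, by omega⟩)
      set s : ℝ := (1 / 16) ^ d ^ (m + 1) with hs
      have hs0 : 0 < s := by positivity
      have h2 : ‖η (N + m + 1) * y ⟨0, by omega⟩‖ ≤ s := by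
        rw [norm_mul]
        calc ‖η (N + m + 1)‖ * ‖y ⟨0, by omega⟩‖ ≤ a ^ d ^ (N + m + 1) * 1 := by
              gcongr
              · exact hη _
              · exact (PiLp.norm_apply_le _ _).trans (hle1 m)
          _ = (a ^ d ^ N) ^ d ^ (m + 1) := by rw [mul_one, ← pow_mul, ← pow_add, add_assoc]
          _ ≤ s := by rw [hs]; gcongr
      have h3 : 4 * s ≤ ‖y ⟨1, hk⟩ ^ d‖ := by
        rw [norm_pow]
        calc 4 * s = 2 ^ 2 * s := by ring
          _ ≤ 2 ^ d * s := by gcongr; norm_num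
          _ = (2 * (1 / 16 : ℝ) ^ d ^ m) ^ d := by rw [mul_pow, hs, ← pow_mul, pow_succ d m]
          _ ≤ _ := by gcongr
      rw [hstep]
      linarith
  refine ⟨w, ?_, ((d : ℝ) ^ N)⁻¹ * Real.log (1 / 16), ?_, ?_⟩
  · rw [hhalf.basin_eq (by norm_num)]
    exact mem_iUnion.2 ⟨0, by simpa [basinPiece] using hFwn⟩
  -- Strictness of log a < c is the hypothesis a^(d^N) < 1/16 after taking logarithms.
  · have hdN : (0 : ℝ) < (d : ℝ) ^ N := by positivity
    rw [inv_mul_eq_div, lt_div_iff₀ hdN]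
    have := Real.log_lt_log (by positivity) hN
    rw [Real.log_pow] at this
    push_cast at this
    linarith
  · intro n hn
    obtain ⟨m, rfl⟩ := Nat.exists_eq_add_of_le hn
    have hd0 : (d : ℝ) ≠ 0 := by positivity
    calc ((d : ℝ) ^ N)⁻¹ * Real.log (1 / 16)
        = ((d : ℝ) ^ (N + m))⁻¹ * Real.log ((1 / 16) ^ d ^ m) := by
          rw [Real.log_pow, pow_add]
          push_cast
          field_simp
      _ ≤ potential F d a (N + m) w := by
          unfold potential
          gcongr
          have h1 := hlow m
          have h2 : ‖compUpTo F (N + m) w ⟨1, hk⟩‖ ≤ ‖compUpTo F (N + m) w‖ :=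
            PiLp.norm_apply_le _ _
          have h3 := le_max_left ‖compUpTo F (N + m) w‖ (a ^ d ^ (N + m))
          have h4 : (0 : ℝ) < (1 / 16) ^ d ^ m := by positivity
          linarith

theorem tendsto_potential_zero (hd : 2 ≤ d) (ha : 0 < a) :
    Tendsto (fun n => potential (fun n => shiftMap k d (η n)) d a n 0) atTop
      (𝓝 (Real.log a)) := by
  have heq : ∀ n, potential (fun n => shiftMap k d (η n)) d a n 0
      = ((d : ℝ) ^ n)⁻¹ * Real.log 2 + Real.log a := by
    intro n
    have h1 : 0 < a ^ d ^ n := by positivity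
    have hd0 : (d : ℝ) ≠ 0 := by positivity
    rw [potential, compUpTo_shiftMap_zero k (by omega), norm_zero, max_eq_right h1.le,
      Real.log_mul two_ne_zero h1.ne', Real.log_pow]
    push_cast
    field_simp
  simp only [heq]
  have hlim : Tendsto (fun n : ℕ => ((d : ℝ) ^ n)⁻¹) atTop (𝓝 0) :=
    (tendsto_pow_atTop_atTop_of_one_lt (by exact_mod_cast hd)).inv_tendsto_atTop
  simpa using (hlim.mul_const (Real.log 2)).add_const (Real.log a)

/-- If one potential takes a value c < 0 at z, monotonicity gives |Φ_n(z)| ≤ exp(d^n c) for all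
later n, which tends to 0. Conversely, convergence to 0 makes the argument of the logarithm
eventually less than 1. -/
theorem basin_eq_iInf_potential_neg (hd : 2 ≤ d) (ha : 0 < a) (ha1 : a < 1)
    (hη : ∀ n, ‖η n‖ ≤ a ^ d ^ n) :
    basin (fun n => shiftMap k d (η n))
      = {z | (⨅ n, potential (fun n => shiftMap k d (η n)) d a n z) < 0} := by
  set F : ℕ → Cn k → Cn k := fun n => shiftMap k d (η n)
  have hbdd : ∀ z, BddBelow (range fun n => potential F d a n z) := fun z =>
    ⟨Real.log a, by rintro _ ⟨n, rfl⟩; exact log_le_potential (by omega) ha n z⟩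
  ext z
  constructor
  · intro hz
    have h1 : ∀ᶠ n in atTop, ‖compUpTo F n z‖ < 1 / 2 := by
      have : Tendsto (fun n => ‖compUpTo F n z‖) atTop (𝓝 0) := by
        simpa using (show Tendsto _ _ _ from hz).norm
      exact this.eventually_lt_const (by norm_num)
    have h2 := (tendsto_pow_pow hd ha ha1).eventually_lt_const (by norm_num : (0 : ℝ) < 1 / 2)
    obtain ⟨n, hn⟩ := (h1.and h2).exists
    exact (ciInf_le (hbdd z) n).trans_lt ((potential_neg_iff (by omega) ha).2 hn)
  · intro hz
    obtain ⟨m, hm⟩ := exists_lt_of_ciInf_lt (show (⨅ n, potential F d a n z) < 0 from hz)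
    set c := potential F d a m z with hc
    have hlim : Tendsto (fun n : ℕ => Real.exp ((d : ℝ) ^ n * c)) atTop (𝓝 0) :=
      Real.tendsto_exp_atBot.comp
        ((tendsto_pow_atTop_atTop_of_one_lt (by exact_mod_cast hd)).atTop_mul_const_of_neg hm)
    change Tendsto (fun n => compUpTo F n z) atTop (𝓝 0)
    refine squeeze_zero_norm' ?_ hlim
    filter_upwards [eventually_ge_atTop m] with n hn
    have hdn : (0 : ℝ) < (d : ℝ) ^ n := by positivity
    have hle : potential F d a n z ≤ c := antitone_potential hd ha ha1 hη z hn
    rw [potential, inv_mul_le_iff₀ hdn, Real.log_le_iff_le_exp (potential_pos_arg ha n z)] at hle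
    linarith [le_max_left ‖compUpTo F n z‖ (a ^ d ^ n), norm_nonneg (compUpTo F n z)]

end

end ShortCk

/-! ### Assembly of the main theorem. -/

open ShortCk in
theorem theorem3p1 (k d : ℕ) (hk : 2 ≤ k) (hd : 2 ≤ d) (a : ℝ) (ha0 : 0 < a) (ha1 : a < 1)
    (η : ℕ → ℂ) (hη0 : ∀ n, η n ≠ 0) (hη : ∀ n, ‖η n‖ ≤ a ^ (d ^ n))
    (Ω : Set (ShortCk.Cn k)) (hΩ : Ω = ShortCk.basin (fun n => ShortCk.shiftMap k d (η n))) :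
    (Ω.Nonempty ∧ IsOpen Ω ∧ IsConnected Ω) ∧
    ShortCk.IsIncreasingUnionOfBalls Ω ∧
    (∀ p ∈ Ω, ∀ ξ : ShortCk.Cn k, ShortCk.kobayashiMetric Ω p ξ = 0) ∧
    (∃ ψ : ShortCk.Cn k → ℝ, ShortCk.IsPSHOn ψ Set.univ ∧ (∀ z, Real.log a ≤ ψ z) ∧
      Ω = {z | ψ z < 0} ∧ ∃ z ∈ Ω, ∃ w ∈ Ω, ψ z ≠ ψ w) ∧
    ShortCk.IsShortCk Ω := by
  have hk0 : 0 < k := by omega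
  set F : ℕ → Cn k → Cn k := fun n => shiftMap k d (η n) with hFdef
  set G : ℕ → Cn k → Cn k := fun n => shiftInv hk0 d (η n)
  have hF : ∀ n, Differentiable ℂ (F n) := fun n => differentiable_shiftMap k d (η n)
  have hG : ∀ n, Differentiable ℂ (G n) := fun n => differentiable_shiftInv hk0 d (η n)
  have hl : ∀ n, Function.LeftInverse (G n) (F n) := fun n => leftInverse_shiftInv hk0 d (hη0 n)
  have hrt : ∀ n, Function.RightInverse (G n) (F n) := fun n =>
    rightInverse_shiftInv hk0 d (hη0 n)
  -- One threshold serves twice: it gives |η_n| ≤ 1/4 for the halving, and a^(d^N) < 1/16 for the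
  -- non-constancy of ψ.
  obtain ⟨N, hN⟩ := eventually_atTop.1
    ((tendsto_pow_pow hd ha0 ha1).eventually_lt_const (by norm_num : (0 : ℝ) < 1 / 16))
  have hhalf : EventuallyHalving F N (1 / 4) := eventuallyHalving_shiftMap k hd fun n hn =>
    ((hη n).trans (hN n hn).le).trans (by norm_num)
  have hr : (0 : ℝ) < 1 / 4 := by norm_num
  have hopen : IsOpen Ω := hΩ ▸ hhalf.isOpen_basin hF hr
  have hconn : IsConnected Ω := hΩ ▸ hhalf.isConnected_basin hG hl hrt hr
  have hballs : IsIncreasingUnionOfBalls Ω :=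
    hΩ ▸ hhalf.isIncreasingUnionOfBalls_basin hF hG hl hrt hr
  have hkob : ∀ p ∈ Ω, ∀ ξ : Cn k, kobayashiMetric Ω p ξ = 0 := by
    subst hΩ
    exact fun p hp ξ => hhalf.kobayashiMetric_basin hF hG hl hrt hr hp ξ
  have hne : Ω ≠ Set.univ := hΩ ▸ basin_shiftMap_ne_univ hk hd fun n =>
    (hη n).trans (pow_le_one₀ ha0.le ha1.le)
  set ψ : Cn k → ℝ := fun z => ⨅ n, potential F d a n z with hψ
  have hlow : ∀ n z, Real.log a ≤ potential F d a n z := log_le_potential (by omega) ha0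
  have hbdd : ∀ z, BddBelow (Set.range fun n => potential F d a n z) := fun z =>
    ⟨Real.log a, by rintro _ ⟨n, rfl⟩; exact hlow n z⟩
  have hanti : ∀ z, Antitone fun n => potential F d a n z := antitone_potential hd ha0 ha1 hη
  have hpsh : IsPSHOn ψ Set.univ := isPSHOn_univ_iInf (continuous_potential hF ha0)
    (isPSHOn_potential hF ha0) hanti hlow
  have hψlow : ∀ z, Real.log a ≤ ψ z := fun z => le_ciInf fun n => hlow n z
  have hΩψ : Ω = {z | ψ z < 0} := hΩ.trans (basin_eq_iInf_potential_neg hd ha0 ha1 hη)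
  have hnonconst : ∃ z ∈ Ω, ∃ w ∈ Ω, ψ z ≠ ψ w := by
    obtain ⟨w, hw, c, hc, hcw⟩ :=
      exists_mem_basin_lt_iInf_potential hk hd ha0 (hN N le_rfl) hη hhalf hrt
    have h0 : (0 : Cn k) ∈ Ω := by
      rw [hΩ]
      exact tendsto_const_nhds.congr fun n =>
        (compUpTo_shiftMap_zero k (by omega : d ≠ 0) η n).symm
    refine ⟨0, h0, w, hΩ ▸ hw, ?_⟩
    have hψ0 : ψ 0 ≤ Real.log a :=
      ge_of_tendsto' (tendsto_potential_zero (η := η) hd ha0) fun n => ciInf_le (hbdd 0) n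
    -- The bound is known only from index `N` on; monotonicity in n extends it to the earlier
    -- indices.
    have hψw : c ≤ ψ w := le_ciInf fun n =>
      (hcw _ (le_max_right n N)).trans (hanti w (le_max_left n N))
    exact (hψ0.trans_lt (hc.trans_le hψw)).ne
  refine ⟨⟨hconn.nonempty, hopen, hconn⟩, hballs, hkob, ⟨ψ, hpsh, hψlow, hΩψ, hnonconst⟩, ?_⟩
  exact ⟨hopen, hconn, hne, hballs, hkob, ψ, hpsh.mono (Set.subset_univ _),
    ⟨Real.log a, 0, fun z hz => ⟨hψlow z, (show z ∈ {z | ψ z < 0} from hΩψ ▸ hz).le⟩⟩, hnonconst⟩
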